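/- Let $u_1=(2,-1,-1)^T/\sqrt6$, $\tilde S=2u_1u_1^\dagger-\mathbb 1\in U(3)$, $\omega=e^{2\pi i/3}$, and let $G_\nu=\{\mathbb 1,\tilde S\}$ be the $\mathbb Z_2$ generated by $\tilde S$. For a group $G_\ell$ of diagonal unitary $3\times3$ matrices let $\bar G$ be the subgroup of $U(3)$ generated by $G_\nu$ and $G_\ell$. (1) A diagonal $\tilde T\in U(3)$ that is not proportional to $\mathbb 1$ is such that both $\tilde T$ and $\tilde S\tilde T$ have finite order if and only if $\tilde T=\eta\,\mathrm{diag}(1,\omega,\omega^2)$ or $\tilde T=\eta\,\mathrm{diag}(1,\omega^2,\omega)$ for some root of unity $\eta$ (these are, up to the choice of $\eta$, all orderings of the diagonal entries). No such matrix is proportional to $\mathbb 1$. (2) If $\tilde T$ is one of these matrices and $\eta$ is a primitive $q$-th root of unity, then $\tilde S$ and $\tilde T$ generate a group isomorphic to $\mathbb Z_q\times S_4$. (3) Let $G_\ell$ be a finite group of diagonal unitary matrices, not all proportional to $\mathbb 1$, such that $\tilde S\tilde T$ has finite order for all $\tilde T\in G_\ell$ (this holds in particular if $\bar G$ is finite).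 Then $\bar G\cong\mathbb Z_q\times S_4$ for some $q\ge1$, and $(G_\ell,G_\nu)$ enforces TM$_1$ in the following sense: let $M_\ell,M_\nu$ be complex $3\times3$ matrices with $M_\nu^T=M_\nu$, $\tilde T^\dagger M_\ell M_\ell^\dagger\tilde T=M_\ell M_\ell^\dagger$ for all $\tilde T\in G_\ell$ and $\tilde S^TM_\nu\tilde S=M_\nu$. Then $M_\ell M_\ell^\dagger$ is diagonal. Moreover, write $M_\ell M_\ell^\dagger=\mathrm{diag}(m_e^2,m_\mu^2,m_\tau^2)$, and assume that $m_e,m_\mu,m_\tau\ge0$ are distinct and that $m_1,m_2,m_3\ge0$ are distinct. If $U_\ell,U_\nu$ are unitary with $U_\ell^\dagger M_\ell M_\ell^\dagger U_\ell=\mathrm{diag}(m_e^2,m_\mu^2,m_\tau^2)$ and $U_\nu^TM_\nu U_\nu=\mathrm{diag}(m_1,m_2,m_3)$, then some column of the mixing matrix $U=U_\ell^\dagger U_\nu$ equals $u_1$ up to phases of its entries. (4) Conversely, for every $q\ge1$ there is a $G_\ell$ as in (3) with $\bar G\cong\mathbb Z_q\times S_4$. Hence the groups $\bar G$ that enforce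 TM$_1$ in this way are, up to isomorphism, exactly the groups $\mathbb Z_q\times S_4$, $q=1,2,3,\dots$ -/

import Mathlib

open scoped Matrix

namespace TM1

/-- The unitary group `U(3)`. -/
abbrev U3 : Type := Matrix.unitaryGroup (Fin 3) ℂ

/-- The unit vector `u₁ = (2, -1, -1)ᵀ / √6`. -/
noncomputable def u₁ : Fin 3 → ℂ :=
  fun i => (![2, -1, -1] : Fin 3 → ℂ) i / ((Real.sqrt 6 : ℝ) : ℂ)

/-- The matrix `2 u₁ u₁† - 1`. -/
noncomputable def STildeMatrix : Matrix (Fin 3) (Fin 3) ℂ :=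
  (2 : ℂ) • Matrix.vecMulVec u₁ (star u₁) - 1

theorem sTildeMatrix_eq :
    STildeMatrix = (1 / 3 : ℂ) • !![1, -2, -2; -2, -2, 1; -2, 1, -2] := by
  have h6 : ((Real.sqrt 6 : ℝ) : ℂ) * ((Real.sqrt 6 : ℝ) : ℂ) = 6 := by
    rw [← Complex.ofReal_mul, Real.mul_self_sqrt (by norm_num)]
    norm_num
  ext i j
  fin_cases i <;> fin_cases j <;>
    simp [STildeMatrix, u₁, Matrix.vecMulVec_apply, div_mul_div_comm, h6] <;> norm_num

theorem sTildeMatrix_mem : STildeMatrix ∈ Matrix.unitaryGroup (Fin 3) ℂ := by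
  rw [Matrix.mem_unitaryGroup_iff, sTildeMatrix_eq, Matrix.star_eq_conjTranspose]
  ext i j
  fin_cases i <;> fin_cases j <;>
    simp [Matrix.mul_apply, Fin.sum_univ_three, map_ofNat] <;> norm_num

/-- The residual symmetry `S̃ = 2 u₁ u₁† - 1` of the neutrino mass matrix, as an element of `U(3)`. -/
noncomputable def STilde : U3 := ⟨STildeMatrix, sTildeMatrix_mem⟩

/-- The group `G_ν` generated by `S̃`. -/
noncomputable def Gν : Subgroup U3 := Subgroup.zpowers STilde

/-- `ω = exp(2πi/3)`. -/
noncomputable def ω : ℂ := Complex.exp (2 * Real.pi * Complex.I / 3)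

/-- `T` is a diagonal matrix. -/
def IsDiagonal (T : U3) : Prop := (T : Matrix (Fin 3) (Fin 3) ℂ).IsDiag

/-- `T` is proportional to the unit matrix. -/
def IsScalar (T : U3) : Prop :=
  ∃ c : ℂ, (T : Matrix (Fin 3) (Fin 3) ℂ) = c • (1 : Matrix (Fin 3) (Fin 3) ℂ)

/-- `T = η diag(1, ω, ω²)` or `T = η diag(1, ω², ω)`. -/
def HasForm (η : ℂ) (T : U3) : Prop :=
  (T : Matrix (Fin 3) (Fin 3) ℂ) = η • Matrix.diagonal ![1, ω, ω ^ 2] ∨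
    (T : Matrix (Fin 3) (Fin 3) ℂ) = η • Matrix.diagonal ![1, ω ^ 2, ω]

/-- The group `Ḡ` generated by the residual symmetries `G_ν` and `G_ℓ`. -/
noncomputable def Gbar (Gl : Subgroup U3) : Subgroup U3 := Gν ⊔ Gl

/-- The premises on the group `G_ℓ` of residual symmetries of the charged-lepton mass matrix,
in the basis where that matrix is diagonal: `G_ℓ` is a finite group of diagonal matrices, it is
not contained in the scalars, and `S̃ T` has finite order for each of its elements `T`. -/
structure IsChargedLeptonGroup (Gl : Subgroup U3) : Prop where
  finite : Finite Gl
  diagonal : ∀ T ∈ Gl, IsDiagonal T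
  finOrder : ∀ T ∈ Gl, IsOfFinOrder (STilde * T)
  nonscalar : ∃ T ∈ Gl, ¬ IsScalar T

/-- `Gl` consists of residual symmetries of `M_ℓ M_ℓ†`. -/
def ChargedInvariant (Gl : Subgroup U3) (Ml : Matrix (Fin 3) (Fin 3) ℂ) : Prop :=
  ∀ T ∈ Gl, (T : Matrix (Fin 3) (Fin 3) ℂ)ᴴ * (Ml * Mlᴴ) * (T : Matrix (Fin 3) (Fin 3) ℂ)
    = Ml * Mlᴴ

/-- `Gn` consists of residual symmetries of the Majorana mass matrix `M_ν`. -/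
def NeutrinoInvariant (Gn : Subgroup U3) (Mn : Matrix (Fin 3) (Fin 3) ℂ) : Prop :=
  ∀ S ∈ Gn, (S : Matrix (Fin 3) (Fin 3) ℂ)ᵀ * Mn * (S : Matrix (Fin 3) (Fin 3) ℂ) = Mn

/-- `U = U_ℓ† U_ν` is a lepton mixing matrix of `M_ℓ` and `M_ν`, with the charged-lepton masses
`ml` and the neutrino masses `mn`: the unitary matrices `U_ℓ` and `U_ν` satisfy
`U_ℓ† M_ℓ M_ℓ† U_ℓ = diag(ml²)` and `U_νᵀ M_ν U_ν = diag(mn)`. -/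
def IsMixingMatrix (Ml Mn : Matrix (Fin 3) (Fin 3) ℂ) (ml mn : Fin 3 → ℝ)
    (U : Matrix (Fin 3) (Fin 3) ℂ) : Prop :=
  ∃ Ul Un : U3,
    (Ul : Matrix (Fin 3) (Fin 3) ℂ)ᴴ * (Ml * Mlᴴ) * (Ul : Matrix (Fin 3) (Fin 3) ℂ)
        = Matrix.diagonal (fun i => ((ml i : ℝ) : ℂ) ^ 2) ∧
    (Un : Matrix (Fin 3) (Fin 3) ℂ)ᵀ * Mn * (Un : Matrix (Fin 3) (Fin 3) ℂ)
        = Matrix.diagonal (fun i => ((mn i : ℝ) : ℂ)) ∧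
    U = (Ul : Matrix (Fin 3) (Fin 3) ℂ)ᴴ * (Un : Matrix (Fin 3) (Fin 3) ℂ)

/-- Up to phases of its entries, some column of `U` is `u₁`. The symmetries do not fix the order
of the neutrino masses, hence not the position of the column; the phases can be absorbed into
the fields. -/
def HasTM1Column (U : Matrix (Fin 3) (Fin 3) ℂ) : Prop :=
  ∃ (j : Fin 3) (p : Fin 3 → ℂ), (∀ i, ‖p i‖ = 1) ∧ ∀ i, U i j = p i * u₁ i

/-- The residual symmetry groups `Gl` and `Gn` enforce TM₁: whenever `M_ℓ M_ℓ†` and the symmetric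
matrix `M_ν` are invariant under them, `M_ℓ M_ℓ†` is diagonal, and, if the charged leptons are
labelled by the basis vectors that they belong to and the masses are non-degenerate, every lepton
mixing matrix has the column `u₁` up to phases. -/
def EnforcesTM1 (Gl Gn : Subgroup U3) : Prop :=
  ∀ Ml Mn : Matrix (Fin 3) (Fin 3) ℂ, Mn.IsSymm →
    ChargedInvariant Gl Ml → NeutrinoInvariant Gn Mn →
      (Ml * Mlᴴ).IsDiag ∧
      ∀ (ml mn : Fin 3 → ℝ) (U : Matrix (Fin 3) (Fin 3) ℂ),
        (∀ i, 0 ≤ ml i) → (∀ i, 0 ≤ mn i) → Function.Injective ml → Function.Injective mn →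
        Ml * Mlᴴ = Matrix.diagonal (fun i => ((ml i : ℝ) : ℂ) ^ 2) →
        IsMixingMatrix Ml Mn ml mn U → HasTM1Column U

/-- `H` is isomorphic to `ℤ_q × S₄`. -/
def IsCyclicTimesS4 (q : ℕ) (H : Subgroup U3) : Prop :=
  Nonempty (H ≃* Multiplicative (ZMod q) × Equiv.Perm (Fin 4))

end TM1

namespace TM1

/-! ### Sums of three roots of unity -/

/-! Let `T = diag(a, b, c)` and `S̃ T` have finite order. Then `a`, `b`, `c` are roots of unity and
`tr (S̃ T) = (a + b + c)/3 - (b + c)` is an algebraic integer, hence so is the mean `(a + b + c)/3`.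
All its conjugates lie in the closed unit disc, so by Kronecker's theorem it is zero or a root of
unity (`eq_or_add_add_eq_zero`). In the second case the triangle inequality is sharp and `T` is
scalar; in the first, `a : b : c` is `1 : ω : ω²` in some order (`hasForm_of_isOfFinOrder`).

Conversely, `S̃` and `diag(1, ω, ω²)` are the images of a transposition and a 3-cycle under the
rotation representation `ρ` of `S₄` (`rotation_swap`, `rotation_threeCycle`), and these generate
`S₄`. The map `(z, σ) ↦ z ρ(σ)` is injective (`scalarRotation_injective`), and `Ḡ` is the image of
`Z × S₄`, where `Z` is the finite, hence cyclic, group of first diagonal entries of `G_ℓ`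
(`gbar_eq`).

For TM₁, a nonscalar `T` has distinct entries, which makes `M_ℓ M_ℓ†` diagonal, and `u₁` spans the
`+1` eigenspace of `S̃`, so `M_ν u₁ = μ u₁`. Non-degeneracy in the Takagi factorization then makes
`u₁` a column of `U_ν` up to a phase. -/

theorem eq_of_norm_add_add {a b c : ℂ} (ha : ‖a‖ = 1) (hb : ‖b‖ = 1) (hc : ‖c‖ = 1)
    (h : ‖a + b + c‖ = 3) : a = b ∧ a = c := by
  have sq (z : ℂ) : ‖z‖ ^ 2 = z.re ^ 2 + z.im ^ 2 := by
    rw [Complex.sq_norm, Complex.normSq_apply]; ring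
  have h1 := sq a
  have h2 := sq b
  have h3 := sq c
  have h4 := sq (a + b + c)
  rw [ha] at h1
  rw [hb] at h2
  rw [hc] at h3
  rw [h] at h4
  simp only [Complex.add_re, Complex.add_im] at h4
  -- The identity `|a-b|² + |a-c|² + |b-c|² = 3(|a|² + |b|² + |c|²) - |a+b+c|²`, whose right side is
  -- `9 - 9`.
  have key : (a.re - b.re) ^ 2 + (a.im - b.im) ^ 2 + ((a.re - c.re) ^ 2 + (a.im - c.im) ^ 2)
      + ((b.re - c.re) ^ 2 + (b.im - c.im) ^ 2) = 0 := by linarith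
  have e1 := sq_nonneg (a.re - b.re)
  have e2 := sq_nonneg (a.im - b.im)
  have e3 := sq_nonneg (a.re - c.re)
  have e4 := sq_nonneg (a.im - c.im)
  have e5 := sq_nonneg (b.re - c.re)
  have e6 := sq_nonneg (b.im - c.im)
  refine ⟨Complex.ext ?_ ?_, Complex.ext ?_ ?_⟩ <;>
    exact sub_eq_zero.1 (pow_eq_zero_iff two_ne_zero |>.1 (by linarith))

/-- An arbitrary embedding `φ` is allowed because Kronecker's theorem needs bounds on all
conjugates. -/
theorem norm_eq_one_of_isOfFinOrder {K : Type*} [Field K] (φ : K →+* ℂ) {x : K}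
    (hx : IsOfFinOrder x) : ‖φ x‖ = 1 := by
  obtain ⟨n, hn, h⟩ := isOfFinOrder_iff_pow_eq_one.1 hx
  exact Complex.norm_eq_one_of_pow_eq_one (by rw [← map_pow, h, map_one]) hn.ne'

/-- If the arithmetic mean of three roots of unity is an algebraic integer, then they are equal
or their sum vanishes. -/
theorem eq_or_add_add_eq_zero {a b c : ℂ} (ha : IsOfFinOrder a) (hb : IsOfFinOrder b)
    (hc : IsOfFinOrder c) (h : IsIntegral ℤ ((a + b + c) / 3)) :
    (a = b ∧ a = c) ∨ a + b + c = 0 := by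
  by_cases h0 : a + b + c = 0
  · exact Or.inr h0
  left
  have hint {x : ℂ} (hx : IsOfFinOrder x) : IsIntegral ℚ x := by
    obtain ⟨n, hn, h⟩ := isOfFinOrder_iff_pow_eq_one.1 hx
    exact IsIntegral.of_pow hn (h ▸ isIntegral_one)
  let K := IntermediateField.adjoin ℚ ({a, b, c} : Set ℂ)
  have : FiniteDimensional ℚ K := by
    apply IntermediateField.finiteDimensional_adjoin
    rintro x (rfl | rfl | rfl)
    exacts [hint ha, hint hb, hint hc]
  have : NumberField K := ⟨⟩
  let a' : K := ⟨a, IntermediateField.subset_adjoin _ _ (by simp)⟩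
  let b' : K := ⟨b, IntermediateField.subset_adjoin _ _ (by simp)⟩
  let c' : K := ⟨c, IntermediateField.subset_adjoin _ _ (by simp)⟩
  have hfin {x : K} (hx : IsOfFinOrder (x : ℂ)) : IsOfFinOrder x :=
    by
    obtain ⟨n, hn, h⟩ := isOfFinOrder_iff_pow_eq_one.1 hx
    exact isOfFinOrder_iff_pow_eq_one.2 ⟨n, hn, Subtype.ext h⟩
  have hx0 : (a' + b' + c') / 3 ≠ 0 := by
    intro h'
    have := congrArg (algebraMap K ℂ) h'
    rw [map_div₀, map_add, map_add, map_ofNat, map_zero] at this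
    exact h0 ((div_eq_zero_iff.1 this).resolve_right (by norm_num))
  -- Kronecker's theorem: each embedding sends `a`, `b`, `c` to the unit circle, so every conjugate
  -- of their mean has norm at most 1.
  obtain ⟨n, hn, hpow⟩ := NumberField.Embeddings.pow_eq_one_of_norm_le_one K ℂ hx0
    (by
      refine (isIntegral_algebraMap_iff (A := K) (B := ℂ) (algebraMap K ℂ).injective).1 ?_
      rw [map_div₀, map_add, map_add, map_ofNat]
      exact h)
    (by
      intro φ
      rw [map_div₀, map_add, map_add, map_ofNat, norm_div]
      have := norm_add₃_le (a := φ a') (b := φ b') (c := φ c')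
      rw [norm_eq_one_of_isOfFinOrder φ (hfin (x := a') ha),
        norm_eq_one_of_isOfFinOrder φ (hfin (x := b') hb),
        norm_eq_one_of_isOfFinOrder φ (hfin (x := c') hc)] at this
      rw [RCLike.norm_ofNat, div_le_one (by norm_num)]
      linarith)
  have h1 : ‖(a + b + c) / 3‖ = 1 := norm_eq_one_of_isOfFinOrder (algebraMap K ℂ)
    (isOfFinOrder_iff_pow_eq_one.2 ⟨n, hn, hpow⟩)
  rw [norm_div, RCLike.norm_ofNat, div_eq_one_iff_eq (by norm_num)] at h1
  exact eq_of_norm_add_add (norm_eq_one_of_isOfFinOrder (RingHom.id ℂ) ha)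
    (norm_eq_one_of_isOfFinOrder (RingHom.id ℂ) hb)
    (norm_eq_one_of_isOfFinOrder (RingHom.id ℂ) hc) h1

/-- The trace is the sum of the eigenvalues, and these are roots of unity by spectral mapping. -/
theorem isIntegral_trace_of_isOfFinOrder {n : Type*} [Fintype n] [DecidableEq n]
    {A : Matrix n n ℂ} (hA : IsOfFinOrder A) : IsIntegral ℤ A.trace := by
  obtain ⟨k, hk, h⟩ := isOfFinOrder_iff_pow_eq_one.1 hA
  rw [Matrix.trace_eq_sum_roots_charpoly]
  refine IsIntegral.multiset_sum fun μ hμ => IsIntegral.of_pow hk ?_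
  have h1 : μ ∈ spectrum ℂ A :=
    Matrix.mem_spectrum_iff_isRoot_charpoly.2 (Polynomial.isRoot_of_mem_roots hμ)
  cases isEmpty_or_nonempty n
  · simp at hμ
  have h2 := spectrum.pow_mem_pow A k h1
  rw [h, spectrum.one_eq, Set.mem_singleton_iff] at h2
  rw [h2]
  exact isIntegral_one

/-! ### The cube root of unity -/

theorem isPrimitiveRoot_omega : IsPrimitiveRoot ω 3 := by
  simpa [ω] using Complex.isPrimitiveRoot_exp 3 (by norm_num)

theorem omega_pow_three : ω ^ 3 = 1 := isPrimitiveRoot_omega.pow_eq_one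

theorem omega_sq_add : ω ^ 2 + ω + 1 = 0 := by
  have h := isPrimitiveRoot_omega.ne_one (by norm_num)
  have : (ω - 1) * (ω ^ 2 + ω + 1) = 0 := by linear_combination omega_pow_three
  exact (mul_eq_zero.1 this).resolve_left (sub_ne_zero.2 h)

theorem omega_ne_one : ω ≠ 1 := isPrimitiveRoot_omega.ne_one (by norm_num)

theorem omega_sq_ne_one : ω ^ 2 ≠ 1 :=
  isPrimitiveRoot_omega.pow_ne_one_of_pos_of_lt (by norm_num) (by norm_num)

theorem omega_ne_omega_sq : ω ≠ ω ^ 2 := fun h =>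
  omega_ne_one (mul_left_cancel₀ (isPrimitiveRoot_omega.ne_zero (by norm_num))
    (by rw [← sq, mul_one]; exact h.symm))

theorem star_omega : star ω = ω ^ 2 := by
  have h : ω * star ω = 1 := by
    rw [Complex.star_def, Complex.mul_conj, Complex.normSq_eq_norm_sq,
      isPrimitiveRoot_omega.norm'_eq_one (by norm_num)]
    norm_num
  calc star ω = ω ^ 2 * (ω * star ω) := by linear_combination (-star ω) * omega_pow_three
    _ = ω ^ 2 := by rw [h, mul_one]

/-- Three complex numbers on the unit circle with vanishing sum are proportional to
`1, ω, ω²` in some order. -/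
theorem eq_omega_of_add_add_eq_zero {a b c : ℂ} (ha : a ∈ unitary ℂ) (hb : b ∈ unitary ℂ)
    (hc : c ∈ unitary ℂ) (h : a + b + c = 0) :
    (b = a * ω ∧ c = a * ω ^ 2) ∨ (b = a * ω ^ 2 ∧ c = a * ω) := by
  have ha' := Unitary.mul_star_self_of_mem ha
  have hb' := Unitary.mul_star_self_of_mem hb
  have hc' := Unitary.mul_star_self_of_mem hc
  have hs : star a + star b + star c = 0 := by rw [← star_add, ← star_add, h, star_zero]
  -- Conjugation inverts `a`, `b`, `c`, so the sum of the inverses vanishes too. With `a + b + c =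
  -- 0` this gives `a² + ab + b² = 0`, which factors over `ω`.
  have hbc : b * c + c * a + a * b = 0 := by
    linear_combination a * b * c * hs - b * c * ha' - a * c * hb' - a * b * hc'
  have hq : (b - a * ω) * (b - a * ω ^ 2) = 0 := by
    linear_combination (-a * b) * omega_sq_add + a ^ 2 * omega_pow_three - hbc
      + (a + b) * h
  have hc0 : c = -a - b := by linear_combination h
  rcases mul_eq_zero.1 hq with h1 | h1
  · left
    constructor
    · linear_combination h1
    · rw [hc0]; linear_combination -h1 - a * omega_sq_add
  · right
    constructor
    · linear_combination h1
    · rw [hc0]; linear_combination -h1 - a * omega_sq_add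

/-! ### The action of `S₄` on the vertices of a tetrahedron -/

/-- The columns are the vertices of a regular tetrahedron, scaled by `√12`. -/
noncomputable def tetrahedron : Matrix (Fin 3) (Fin 4) ℂ :=
  !![3, -1, -1, -1; 0, 2, 2 * ω, 2 * ω ^ 2; 0, 2, 2 * ω ^ 2, 2 * ω]

theorem tetrahedron_mul_conjTranspose :
    tetrahedron * tetrahedronᴴ = (12 : ℂ) • (1 : Matrix (Fin 3) (Fin 3) ℂ) := by
  have h := omega_sq_add
  have h3 := omega_pow_three
  have hs : (starRingEnd ℂ) ω = ω ^ 2 := star_omega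
  ext i j
  fin_cases i <;> fin_cases j <;>
    simp [tetrahedron, Matrix.mul_apply, Fin.sum_univ_succ, map_ofNat, hs] <;> grind

/-- The Gram matrix of the vertices is 12 times the projection orthogonal to the all-ones vector. -/
theorem conjTranspose_mul_tetrahedron :
    tetrahedronᴴ * tetrahedron =
      (12 : ℂ) • (1 : Matrix (Fin 4) (Fin 4) ℂ) - Matrix.of fun _ _ => 3 := by
  have h := omega_sq_add
  have h3 := omega_pow_three
  have hs : (starRingEnd ℂ) ω = ω ^ 2 := star_omega
  ext i j
  fin_cases i <;> fin_cases j <;>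
    simp [tetrahedron, Matrix.mul_apply, Fin.sum_univ_succ, map_ofNat, hs] <;> grind

theorem sum_tetrahedron (i : Fin 3) : ∑ j, tetrahedron i j = 0 := by
  have h := omega_sq_add
  fin_cases i <;> simp [tetrahedron, Fin.sum_univ_succ] <;> grind

/-- The matrix that permutes the vertices of the tetrahedron by `σ`, times the sign of `σ`. -/
noncomputable def rotationMatrix (σ : Equiv.Perm (Fin 4)) : Matrix (Fin 3) (Fin 3) ℂ :=
  ((Equiv.Perm.sign σ : ℤ) / 12 : ℂ) • (tetrahedron.submatrix id σ * tetrahedronᴴ)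

theorem rotationMatrix_mul_tetrahedron (σ : Equiv.Perm (Fin 4)) :
    rotationMatrix σ * tetrahedron =
      ((Equiv.Perm.sign σ : ℤ) : ℂ) • tetrahedron.submatrix id σ := by
  -- The vertices sum to zero in any order, which kills the all-ones part of the Gram matrix.
  have h0 : tetrahedron.submatrix id σ * (Matrix.of fun _ _ => 3 : Matrix (Fin 4) (Fin 4) ℂ)
      = 0 := by
    ext i j
    simp only [Matrix.mul_apply, Matrix.submatrix_apply, id, Matrix.of_apply, Matrix.zero_apply]
    rw [← Finset.sum_mul, Equiv.sum_comp σ (tetrahedron i), sum_tetrahedron, zero_mul]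
  rw [rotationMatrix, Matrix.smul_mul, Matrix.mul_assoc, conjTranspose_mul_tetrahedron,
    Matrix.mul_sub, h0, sub_zero, Matrix.mul_smul, Matrix.mul_one, smul_smul]
  congr 1
  ring

theorem rotationMatrix_one : rotationMatrix 1 = 1 := by
  have : tetrahedron.submatrix id (1 : Equiv.Perm (Fin 4)) = tetrahedron := rfl
  rw [rotationMatrix, this, tetrahedron_mul_conjTranspose, smul_smul]
  simp

theorem rotationMatrix_mul (σ τ : Equiv.Perm (Fin 4)) :
    rotationMatrix (σ * τ) = rotationMatrix σ * rotationMatrix τ := by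
  have h : rotationMatrix σ * tetrahedron.submatrix id τ =
      ((Equiv.Perm.sign σ : ℤ) : ℂ) • tetrahedron.submatrix id (σ * τ) := by
    have := congrArg (fun A => A.submatrix id τ) (rotationMatrix_mul_tetrahedron σ)
    exact this
  rw [rotationMatrix, rotationMatrix.eq_def τ, Matrix.mul_smul, ← Matrix.mul_assoc, h,
    Matrix.smul_mul, smul_smul]
  congr 1
  simp
  ring

theorem star_rotationMatrix (σ : Equiv.Perm (Fin 4)) :
    star (rotationMatrix σ) = rotationMatrix σ⁻¹ := by
  have h : tetrahedron * (tetrahedron.submatrix id σ)ᴴ =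
      tetrahedron.submatrix id (σ⁻¹ : Equiv.Perm (Fin 4)) * tetrahedronᴴ := by
    ext i j
    simp only [Matrix.mul_apply, Matrix.conjTranspose_apply, Matrix.submatrix_apply, id]
    rw [← Equiv.sum_comp σ fun k => tetrahedron i (σ⁻¹ k) * star (tetrahedron j k)]
    simp
  rw [rotationMatrix, rotationMatrix, Matrix.star_eq_conjTranspose, Matrix.conjTranspose_smul,
    Matrix.conjTranspose_mul, Matrix.conjTranspose_conjTranspose, h]
  congr 1
  simp

/-- The representation of `S₄` as the rotation group of a cube, in a complex basis. -/
noncomputable def rotation : Equiv.Perm (Fin 4) →* U3 where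
  toFun σ := ⟨rotationMatrix σ, by
    rw [Matrix.mem_unitaryGroup_iff, star_rotationMatrix, ← rotationMatrix_mul, mul_inv_cancel,
      rotationMatrix_one]⟩
  map_one' := Subtype.ext rotationMatrix_one
  map_mul' σ τ := Subtype.ext (rotationMatrix_mul σ τ)

/-- Vertices 0 and 1 differ by a multiple of `u₁`, so exchanging them is the reflection `1 - 2 u₁
u₁†`; the sign of the transposition turns it into `S̃`. -/
theorem rotation_swap : rotation (Equiv.swap 0 1) = STilde := by
  have h := omega_sq_add
  have h3 := omega_pow_three
  have hs : (starRingEnd ℂ) ω = ω ^ 2 := star_omega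
  have e2 : (Equiv.swap 0 1 : Equiv.Perm (Fin 4)) 2 = 2 := by decide
  have e3 : (Equiv.swap 0 1 : Equiv.Perm (Fin 4)) 3 = 3 := by decide
  have hsign : Equiv.Perm.sign (Equiv.swap 0 1 : Equiv.Perm (Fin 4)) = -1 := by decide
  apply Subtype.ext
  change rotationMatrix _ = STildeMatrix
  rw [sTildeMatrix_eq, rotationMatrix, hsign]
  ext i j
  fin_cases i <;> fin_cases j <;>
    simp [tetrahedron, Matrix.mul_apply, Fin.sum_univ_four, map_ofNat, hs, e2, e3] <;> grind

/-- The 3-cycle `(1 2 3)` on `{0, 1, 2, 3}`. -/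
def threeCycle : Equiv.Perm (Fin 4) := Equiv.swap 1 2 * Equiv.swap 2 3

theorem rotation_threeCycle :
    (rotation threeCycle : Matrix (Fin 3) (Fin 3) ℂ) = Matrix.diagonal ![1, ω, ω ^ 2] := by
  have h := omega_sq_add
  have h3 := omega_pow_three
  have hs : (starRingEnd ℂ) ω = ω ^ 2 := star_omega
  have e0 : threeCycle 0 = 0 := by decide
  have e1 : threeCycle 1 = 2 := by decide
  have e2 : threeCycle 2 = 3 := by decide
  have e3 : threeCycle 3 = 1 := by decide
  have hsign : Equiv.Perm.sign threeCycle = 1 := by decide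
  change rotationMatrix _ = _
  rw [rotationMatrix, hsign]
  ext i j
  fin_cases i <;> fin_cases j <;>
    simp [tetrahedron, Matrix.mul_apply, Fin.sum_univ_four, map_ofNat, hs, e0, e1, e2, e3] <;>
    grind

theorem rotation_threeCycle_sq :
    (rotation (threeCycle ^ 2) : Matrix (Fin 3) (Fin 3) ℂ) = Matrix.diagonal ![1, ω ^ 2, ω] := by
  rw [map_pow, sq]
  change (rotation threeCycle : Matrix (Fin 3) (Fin 3) ℂ) * rotation threeCycle = _
  rw [rotation_threeCycle, Matrix.diagonal_mul_diagonal]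
  have h : ω ^ 2 * ω ^ 2 = ω := by linear_combination ω * omega_pow_three
  congr 1
  ext i
  fin_cases i <;> simp [h, ← sq]

/-- The product of the two generators is the 4-cycle `finRotate 4`, which together with an adjacent
transposition generates `S₄`. -/
theorem closure_swap_threeCycle :
    Subgroup.closure {Equiv.swap 0 1, threeCycle} = (⊤ : Subgroup (Equiv.Perm (Fin 4))) := by
  rw [eq_top_iff, ← Equiv.Perm.closure_cycle_adjacent_swap (σ := finRotate 4) isCycle_finRotate
    support_finRotate 0, Subgroup.closure_le]
  have h1 : Equiv.swap 0 1 ∈ Subgroup.closure {Equiv.swap 0 1, threeCycle} :=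
    Subgroup.subset_closure (Set.mem_insert _ _)
  have h2 : threeCycle ∈ Subgroup.closure {Equiv.swap 0 1, threeCycle} :=
    Subgroup.subset_closure (Set.mem_insert_of_mem _ rfl)
  rintro _ (rfl | rfl)
  · have : finRotate 4 = Equiv.swap 0 1 * threeCycle := by decide
    rw [this]
    exact mul_mem h1 h2
  · exact h1

/-! ### Scalar matrices -/

/-- The scalar unitary matrices. -/
noncomputable def scalar : unitary ℂ →* U3 where
  toFun z := ⟨(z : ℂ) • 1, by
    rw [Matrix.mem_unitaryGroup_iff, star_smul, star_one, smul_mul_smul_comm, mul_one,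
      Unitary.mul_star_self_of_mem z.2, one_smul]⟩
  map_one' := Subtype.ext (one_smul _ _)
  map_mul' z w := Subtype.ext (by simp [smul_smul, mul_comm])

theorem coe_scalar_mul (z : unitary ℂ) (T : U3) :
    ((scalar z * T : U3) : Matrix (Fin 3) (Fin 3) ℂ) =
      (z : ℂ) • (T : Matrix (Fin 3) (Fin 3) ℂ) :=
  smul_one_mul (z : ℂ) (T : Matrix (Fin 3) (Fin 3) ℂ)

theorem commute_scalar (z : unitary ℂ) (T : U3) : Commute (scalar z) T :=
  Subtype.ext (by
    rw [coe_scalar_mul]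
    exact (mul_smul_one (z : ℂ) (T : Matrix (Fin 3) (Fin 3) ℂ)).symm)

/-- The homomorphism `(z, σ) ↦ z ρ(σ)`. -/
noncomputable def scalarRotation : unitary ℂ × Equiv.Perm (Fin 4) →* U3 :=
  MonoidHom.noncommCoprod scalar rotation fun z _ => commute_scalar z _

/-- A kernel element satisfies `v_j = c v_{σ j}` for all vertices, with `|c| = 1`. The first
coordinates `3, -1, -1, -1` force `σ 0 = 0` and `c = 1`; distinctness of the vertices then gives `σ
= 1`. -/
theorem scalarRotation_injective : Function.Injective scalarRotation := by
  rw [injective_iff_map_eq_one]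
  rintro ⟨z, σ⟩ h
  have h1 : (z : ℂ) • rotationMatrix σ = 1 := by
    rw [← show ((scalar z * rotation σ : U3) : Matrix (Fin 3) (Fin 3) ℂ) =
      (z : ℂ) • rotationMatrix σ from coe_scalar_mul z _]
    exact congrArg Subtype.val h
  set c : ℂ := z * ((Equiv.Perm.sign σ : ℤ) : ℂ) with hc
  have h2 : tetrahedron = c • tetrahedron.submatrix id σ := by
    rw [hc, mul_smul, ← rotationMatrix_mul_tetrahedron, ← Matrix.smul_mul, h1, Matrix.one_mul]
  have h3 (i j) : tetrahedron i j = c * tetrahedron i (σ j) := congrFun₂ h2 i j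
  have hrow (j : Fin 4) : tetrahedron 0 j = if j = 0 then 3 else -1 := by
    fin_cases j <;> simp [tetrahedron]
  have hcn : ‖c‖ = 1 := by
    have hz : ‖(z : ℂ)‖ = 1 := CStarRing.norm_of_mem_unitary z.2
    rw [hc, norm_mul, hz, one_mul]
    rcases Int.units_eq_one_or (Equiv.Perm.sign σ) with h | h <;> simp [h]
  have hσ0 : σ 0 = 0 := by
    by_contra hne
    have := congrArg norm (h3 0 0)
    rw [hrow, hrow, if_pos rfl, if_neg hne, norm_mul, hcn] at this
    norm_num at this
  have hc1 : c = 1 := by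
    have := h3 0 0
    rw [hσ0, hrow, if_pos rfl] at this
    linear_combination (-1 / 3) * this
  have hσ : σ = 1 := by
    have hinj (j k : Fin 4) (h : ∀ i, tetrahedron i j = tetrahedron i k) : j = k := by
      have h0 := h 0
      have h1 := h 1
      have n1 := omega_ne_one
      have n2 := omega_sq_ne_one
      have n3 := omega_ne_omega_sq
      fin_cases j <;> fin_cases k <;> simp [tetrahedron] at h0 h1 ⊢ <;> grind
    ext j
    rw [← hinj j (σ j) fun i => by rw [h3 i j, hc1, one_mul]]
    rfl
  have hz : z = 1 := by
    subst hσ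
    ext
    simpa [hc1] using hc.symm
  rw [hz, hσ]
  rfl

/-! ### Diagonal unitary matrices -/

theorem IsDiagonal.eq_diagonal {T : U3} (hT : IsDiagonal T) :
    (T : Matrix (Fin 3) (Fin 3) ℂ) = Matrix.diagonal fun i => T.1 i i :=
  hT.diagonal_diag.symm

theorem IsDiagonal.entry_mem {T : U3} (hT : IsDiagonal T) (i : Fin 3) : T.1 i i ∈ unitary ℂ := by
  have h := Matrix.mem_unitaryGroup_iff.1 T.2
  rw [hT.eq_diagonal, Matrix.star_eq_conjTranspose, Matrix.diagonal_conjTranspose,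
    Matrix.diagonal_mul_diagonal] at h
  have := congrFun₂ h i i
  rw [Matrix.diagonal_apply_eq, Matrix.one_apply_eq] at this
  exact Unitary.mem_iff.2 ⟨by rw [mul_comm]; exact this, this⟩

theorem IsDiagonal.isOfFinOrder_entry {T : U3} (hT : IsDiagonal T) (h : IsOfFinOrder T)
    (i : Fin 3) : IsOfFinOrder (T.1 i i) := by
  obtain ⟨n, hn, h⟩ := isOfFinOrder_iff_pow_eq_one.1 h
  refine isOfFinOrder_iff_pow_eq_one.2 ⟨n, hn, ?_⟩
  have h1 : (T : Matrix (Fin 3) (Fin 3) ℂ) ^ n = 1 := congrArg Subtype.val h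
  rw [hT.eq_diagonal, Matrix.diagonal_pow] at h1
  simpa using congrFun₂ h1 i i

theorem trace_sTilde_mul_diagonal (v : Fin 3 → ℂ) :
    (STildeMatrix * Matrix.diagonal v).trace = (v 0 - 2 * v 1 - 2 * v 2) / 3 := by
  rw [sTildeMatrix_eq, Matrix.trace, Fin.sum_univ_three]
  simp only [Matrix.diag_apply, Matrix.mul_diagonal]
  simp
  ring

/-- The mean differs from `tr (S̃ T)` by the sum of two roots of unity. -/
theorem isIntegral_mean_of_isOfFinOrder {T : U3} (hT : IsDiagonal T) (h : IsOfFinOrder T)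
    (hS : IsOfFinOrder (STilde * T)) :
    IsIntegral ℤ ((T.1 0 0 + T.1 1 1 + T.1 2 2) / 3) := by
  have h1 : IsOfFinOrder (STildeMatrix * T.1) :=
    by
    obtain ⟨n, hn, h⟩ := isOfFinOrder_iff_pow_eq_one.1 hS
    exact isOfFinOrder_iff_pow_eq_one.2 ⟨n, hn, congrArg Subtype.val h⟩
  have h2 : IsIntegral ℤ ((T.1 0 0 - 2 * T.1 1 1 - 2 * T.1 2 2) / 3) := by
    rw [← trace_sTilde_mul_diagonal fun i => T.1 i i, ← hT.eq_diagonal]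
    exact isIntegral_trace_of_isOfFinOrder h1
  have hint (i : Fin 3) : IsIntegral ℤ (T.1 i i) := by
    obtain ⟨n, hn, h⟩ := isOfFinOrder_iff_pow_eq_one.1 (hT.isOfFinOrder_entry h i)
    exact IsIntegral.of_pow hn (h ▸ isIntegral_one)
  have h3 : (T.1 0 0 + T.1 1 1 + T.1 2 2) / 3 =
      (T.1 0 0 - 2 * T.1 1 1 - 2 * T.1 2 2) / 3 + (T.1 1 1 + T.1 2 2) := by ring
  rw [h3]
  exact h2.add ((hint 1).add (hint 2))

theorem hasForm_of_isOfFinOrder {T : U3} (hT : IsDiagonal T) (hs : ¬ IsScalar T)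
    (h : IsOfFinOrder T) (hS : IsOfFinOrder (STilde * T)) : HasForm (T.1 0 0) T := by
  have h0 : T.1 0 0 + T.1 1 1 + T.1 2 2 = 0 := by
    refine (eq_or_add_add_eq_zero (hT.isOfFinOrder_entry h 0) (hT.isOfFinOrder_entry h 1)
      (hT.isOfFinOrder_entry h 2) (isIntegral_mean_of_isOfFinOrder hT h hS)).resolve_left ?_
    rintro ⟨h1, h2⟩
    refine hs ⟨T.1 0 0, ?_⟩
    rw [Matrix.smul_one_eq_diagonal]
    conv_lhs => rw [hT.eq_diagonal]
    congr 1
    ext i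
    fin_cases i
    exacts [rfl, h1.symm, h2.symm]
  have h1 (w : Fin 3 → ℂ) (hw : ∀ i, T.1 i i = T.1 0 0 * w i) :
      T.1 = T.1 0 0 • Matrix.diagonal w := by
    rw [← Matrix.diagonal_smul]
    conv_lhs => rw [hT.eq_diagonal]
    congr 1
    ext i
    exact hw i
  refine (eq_omega_of_add_add_eq_zero (hT.entry_mem 0) (hT.entry_mem 1) (hT.entry_mem 2)
    h0).imp ?_ ?_ <;>
  · rintro ⟨e1, e2⟩
    refine h1 _ fun i => ?_
    fin_cases i
    exacts [(mul_one _).symm, e1, e2]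

theorem HasForm.injective_entry {η : ℂ} {T : U3} (hη : η ≠ 0) (h : HasForm η T) :
    Function.Injective fun i => T.1 i i := by
  have n1 := omega_ne_one
  have n2 := omega_sq_ne_one
  have n3 := omega_ne_omega_sq
  intro i j hij
  rcases h with h | h <;> simp only [h, Matrix.smul_apply, Matrix.diagonal_apply_eq, smul_eq_mul]
    at hij <;> replace hij := mul_left_cancel₀ hη hij <;> fin_cases i <;> fin_cases j <;>
    simp [n1, n2, n3, n1.symm, n2.symm, n3.symm] at hij ⊢

theorem HasForm.not_isScalar {η : ℂ} {T : U3} (hη : η ≠ 0) (h : HasForm η T) :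
    ¬ IsScalar T := by
  rintro ⟨c, hc⟩
  exact absurd (h.injective_entry hη (a₁ := 0) (a₂ := 1) (by simp [hc])) (by decide)

theorem HasForm.isDiagonal {η : ℂ} {T : U3} (h : HasForm η T) : IsDiagonal T := by
  rcases h with h | h <;>
  · rw [IsDiagonal, h, ← Matrix.diagonal_smul]
    exact Matrix.isDiag_diagonal _

/-- The first diagonal entry. -/
def IsDiagonal.entry {T : U3} (hT : IsDiagonal T) : unitary ℂ := ⟨T.1 0 0, hT.entry_mem 0⟩

theorem coe_scalarRotation (z : unitary ℂ) (σ : Equiv.Perm (Fin 4)) :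
    (scalarRotation (z, σ) : Matrix (Fin 3) (Fin 3) ℂ) =
      (z : ℂ) • (rotation σ : Matrix (Fin 3) (Fin 3) ℂ) :=
  coe_scalar_mul z (rotation σ)

theorem scalarRotation_one (σ : Equiv.Perm (Fin 4)) : scalarRotation (1, σ) = rotation σ := by
  change scalar 1 * rotation σ = rotation σ
  rw [map_one, one_mul]

theorem hasForm_iff {z : unitary ℂ} {T : U3} :
    HasForm z T ↔ T = scalarRotation (z, threeCycle) ∨ T = scalarRotation (z, threeCycle ^ 2) := by
  rw [HasForm, ← rotation_threeCycle, ← rotation_threeCycle_sq, ← coe_scalarRotation,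
    ← coe_scalarRotation, Subtype.coe_inj, Subtype.coe_inj]

theorem sTilde_mul_scalarRotation (z : unitary ℂ) (σ : Equiv.Perm (Fin 4)) :
    STilde * scalarRotation (z, σ) = scalarRotation (z, Equiv.swap 0 1 * σ) := by
  rw [← rotation_swap, ← scalarRotation_one, ← map_mul, Prod.mk_mul_mk, one_mul]

theorem isOfFinOrder_scalarRotation {z : unitary ℂ} (hz : IsOfFinOrder z)
    (σ : Equiv.Perm (Fin 4)) : IsOfFinOrder (scalarRotation (z, σ)) :=
  scalarRotation.isOfFinOrder (hz.prod_mk (isOfFinOrder_of_finite σ))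

theorem isDiagonal_scalarRotation (z : unitary ℂ) (n : ℕ) :
    IsDiagonal (scalarRotation (z, threeCycle ^ n)) := by
  have : (rotation (threeCycle ^ n) : Matrix (Fin 3) (Fin 3) ℂ) =
      (rotation threeCycle : Matrix (Fin 3) (Fin 3) ℂ) ^ n := by
    rw [map_pow]
    rfl
  rw [IsDiagonal, coe_scalarRotation, this, rotation_threeCycle, Matrix.diagonal_pow,
    ← Matrix.diagonal_smul]
  exact Matrix.isDiag_diagonal _

theorem IsScalar.eq_scalarRotation {T : U3} (hT : IsDiagonal T) (h : IsScalar T) :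
    T = scalarRotation (hT.entry, 1) := by
  obtain ⟨c, hc⟩ := h
  have hc0 : T.1 0 0 = c := by simp [hc]
  apply Subtype.ext
  rw [coe_scalarRotation, map_one, hc, ← hc0]
  rfl

theorem exists_eq_scalarRotation {T : U3} (hT : IsDiagonal T) (h : IsOfFinOrder T)
    (hS : IsOfFinOrder (STilde * T)) : ∃ n : ℕ, T = scalarRotation (hT.entry, threeCycle ^ n) := by
  by_cases hs : IsScalar T
  · exact ⟨0, hs.eq_scalarRotation hT⟩
  · rcases hasForm_iff.1 (show HasForm hT.entry T from hasForm_of_isOfFinOrder hT hs h hS)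
      with h | h
    · exact ⟨1, h⟩
    · exact ⟨2, h⟩

/-! ### The group generated by the residual symmetries -/

/-- Taking the first diagonal entry is a homomorphism on a group of diagonal matrices. -/
def entryHom (Gl : Subgroup U3) (h : ∀ T ∈ Gl, IsDiagonal T) : Gl →* unitary ℂ where
  toFun T := (h T T.2).entry
  map_one' := Subtype.ext (Matrix.one_apply_eq 0)
  map_mul' T R := Subtype.ext (by
    change (T.1.1 * R.1.1) 0 0 = T.1.1 0 0 * R.1.1 0 0
    rw [(h T T.2).eq_diagonal, Matrix.diagonal_mul, Matrix.diagonal_apply_eq])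

/-- A group that contains `S̃` and `T = z diag(1, ω, ω²)` or `T = z diag(1, ω², ω)` contains `z`,
because `T³ = z³` and `(S̃ T)⁴ = z⁴`. -/
theorem scalarRotation_mem_of_hasForm {H : Subgroup U3} (hS : STilde ∈ H) {z : unitary ℂ} {T : U3}
    (hT : T ∈ H) (h : HasForm z T) (σ : Equiv.Perm (Fin 4)) : scalarRotation (z, σ) ∈ H := by
  -- Both diagonal forms at once: `τ` is a 3-cycle on `{1, 2, 3}`, and its product with the
  -- transposition is a 4-cycle.
  obtain ⟨τ, hTτ, h3, h4, hc⟩ : ∃ τ, T = scalarRotation (z, τ) ∧ τ ^ 3 = 1 ∧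
      (Equiv.swap 0 1 * τ) ^ 4 = 1 ∧ (τ = threeCycle ∨ τ ^ 2 = threeCycle) := by
    rcases hasForm_iff.1 h with h | h
    · exact ⟨_, h, by decide, by decide, by decide⟩
    · exact ⟨_, h, by decide, by decide, by decide⟩
  subst hTτ
  have hz3 : scalarRotation (z ^ 3, 1) ∈ H := by
    have := H.pow_mem hT 3
    rwa [← map_pow, Prod.pow_mk, h3] at this
  have hz4 : scalarRotation (z ^ 4, 1) ∈ H := by
    have := H.pow_mem (H.mul_mem hS hT) 4
    rwa [sTilde_mul_scalarRotation, ← map_pow, Prod.pow_mk, h4] at this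
  have hz : scalarRotation (z, 1) ∈ H := by
    have := H.mul_mem hz4 (H.inv_mem hz3)
    rw [← map_inv, ← map_mul] at this
    convert this using 2
    ext1
    · simp only [Prod.fst_mul, Prod.fst_inv]
      group
    · simp
  have hτ : scalarRotation (1, τ) ∈ H := by
    have := H.mul_mem (H.inv_mem hz) hT
    rw [← map_inv, ← map_mul] at this
    simpa using this
  have hle : (⊤ : Subgroup (Equiv.Perm (Fin 4))) ≤ H.comap rotation := by
    rw [← closure_swap_threeCycle, Subgroup.closure_le]
    rintro _ (rfl | rfl)
    · rw [SetLike.mem_coe, Subgroup.mem_comap, rotation_swap]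
      exact hS
    · rw [SetLike.mem_coe, Subgroup.mem_comap]
      rcases hc with hc | hc
      · rw [← hc, ← scalarRotation_one]
        exact hτ
      · rw [← hc, map_pow, ← scalarRotation_one]
        exact H.pow_mem hτ 2
  have hσ := H.mul_mem hz (hle (Subgroup.mem_top σ))
  rw [← scalarRotation_one, ← map_mul] at hσ
  simpa using hσ

theorem IsChargedLeptonGroup.isOfFinOrder {Gl : Subgroup U3} (h : IsChargedLeptonGroup Gl) {T : U3}
    (hT : T ∈ Gl) : IsOfFinOrder T := by
  have := h.finite
  obtain ⟨n, hn, h⟩ := isOfFinOrder_iff_pow_eq_one.1 (isOfFinOrder_of_finite (⟨T, hT⟩ : Gl))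
  exact isOfFinOrder_iff_pow_eq_one.2 ⟨n, hn, congrArg Subtype.val h⟩

theorem IsChargedLeptonGroup.exists_hasForm {Gl : Subgroup U3} (h : IsChargedLeptonGroup Gl) :
    ∃ T ∈ Gl, ∃ z : unitary ℂ, HasForm z T := by
  obtain ⟨T, hT, hs⟩ := h.nonscalar
  exact ⟨T, hT, (h.diagonal T hT).entry,
    hasForm_of_isOfFinOrder (h.diagonal T hT) hs (h.isOfFinOrder hT) (h.finOrder T hT)⟩

/-- Each element of `Gl` is its first entry times a power of `ρ(threeCycle)`. A nonscalar element
puts all of `ρ(S₄)` into `Ḡ`; removing the 3-cycle part then leaves the scalar. -/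
theorem IsChargedLeptonGroup.gbar_eq {Gl : Subgroup U3} (h : IsChargedLeptonGroup Gl) :
    Gbar Gl = ((entryHom Gl h.diagonal).range.prod ⊤).map scalarRotation := by
  apply le_antisymm
  · rw [Gbar, Gν, sup_le_iff, Subgroup.zpowers_le]
    constructor
    · refine ⟨(1, Equiv.swap 0 1), ⟨one_mem _, Subgroup.mem_top _⟩, ?_⟩
      rw [scalarRotation_one, rotation_swap]
    · intro T hT
      obtain ⟨n, hn⟩ := exists_eq_scalarRotation (h.diagonal T hT) (h.isOfFinOrder hT)
        (h.finOrder T hT)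
      exact ⟨_, ⟨⟨⟨T, hT⟩, rfl⟩, Subgroup.mem_top _⟩, hn.symm⟩
  · have hle : Gl ≤ Gbar Gl := le_sup_right
    have hS : STilde ∈ Gbar Gl := (le_sup_left : Gν ≤ _) (Subgroup.mem_zpowers STilde)
    have hρ (σ : Equiv.Perm (Fin 4)) : scalarRotation (1, σ) ∈ Gbar Gl := by
      obtain ⟨T, hT, z, hz⟩ := h.exists_hasForm
      have := mul_mem (inv_mem (scalarRotation_mem_of_hasForm hS (hle hT) hz 1))
        (scalarRotation_mem_of_hasForm hS (hle hT) hz σ)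
      rw [← map_inv, ← map_mul] at this
      simpa using this
    rintro _ ⟨⟨_, σ⟩, ⟨⟨T, rfl⟩, -⟩, rfl⟩
    obtain ⟨n, hn⟩ := exists_eq_scalarRotation (h.diagonal T T.2) (h.isOfFinOrder T.2)
      (h.finOrder T T.2)
    have := mul_mem (hle T.2) (hρ ((threeCycle ^ n)⁻¹ * σ))
    rw [hn, ← map_mul, Prod.mk_mul_mk, mul_one, mul_inv_cancel_left] at this
    exact this

theorem IsChargedLeptonGroup.finite_range {Gl : Subgroup U3} (h : IsChargedLeptonGroup Gl) :
    Finite (entryHom Gl h.diagonal).range :=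
  have := h.finite
  Finite.of_surjective _ (entryHom Gl h.diagonal).rangeRestrict_surjective

theorem IsChargedLeptonGroup.isCyclicTimesS4 {Gl : Subgroup U3} (h : IsChargedLeptonGroup Gl) :
    IsCyclicTimesS4 (Nat.card (entryHom Gl h.diagonal).range) (Gbar Gl) := by
  have := h.finite_range
  -- A finite group that embeds in the multiplicative monoid of a field is cyclic.
  have hc : IsCyclic (entryHom Gl h.diagonal).range :=
    isCyclic_of_injective_ringHom
      ((unitary ℂ).subtype.comp (entryHom Gl h.diagonal).range.subtype)
      (Subtype.coe_injective.comp Subtype.coe_injective)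
  rw [IsCyclicTimesS4, h.gbar_eq]
  exact ⟨(Subgroup.equivMapOfInjective _ _ scalarRotation_injective).symm.trans
    ((Subgroup.prodEquiv _ _).trans
      (MulEquiv.prodCongr (zmodCyclicMulEquiv hc).symm Subgroup.topEquiv))⟩

theorem mem_unitary_of_isPrimitiveRoot {η : ℂ} {q : ℕ} (hq : 0 < q) (hη : IsPrimitiveRoot η q) :
    η ∈ unitary ℂ := by
  have h : η * star η = 1 := by
    rw [Complex.star_def, Complex.mul_conj, Complex.normSq_eq_norm_sq, hη.norm'_eq_one hq.ne']
    norm_num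
  exact Unitary.mem_iff.2 ⟨by rwa [mul_comm], h⟩

theorem isChargedLeptonGroup_zpowers {z : unitary ℂ} (hz : IsOfFinOrder z) {T : U3}
    (h : HasForm z T) : IsChargedLeptonGroup (Subgroup.zpowers T) := by
  obtain ⟨k, hk⟩ : ∃ k : ℕ, T = scalarRotation (z, threeCycle ^ k) := by
    rcases hasForm_iff.1 h with h | h
    · exact ⟨1, h⟩
    · exact ⟨2, h⟩
  have hT : IsOfFinOrder T := hk ▸ isOfFinOrder_scalarRotation hz _
  have hpow (R : U3) (hR : R ∈ Subgroup.zpowers T) :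
      ∃ n : ℕ, R = scalarRotation (z ^ n, threeCycle ^ (k * n)) := by
    -- Natural exponents suffice because `T` has finite order.
    obtain ⟨n, rfl⟩ := hT.mem_powers_iff_mem_zpowers.2 hR
    exact ⟨n, by simp only [hk, ← map_pow, Prod.pow_mk, ← pow_mul]⟩
  refine ⟨?_, fun R hR => ?_, fun R hR => ?_, T, Subgroup.mem_zpowers T,
    h.not_isScalar Unitary.isUnit_coe.ne_zero⟩
  · exact hT.finite_zpowers
  · obtain ⟨n, rfl⟩ := hpow R hR
    exact isDiagonal_scalarRotation _ _
  · obtain ⟨n, rfl⟩ := hpow R hR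
    rw [sTilde_mul_scalarRotation]
    exact isOfFinOrder_scalarRotation hz.pow _

theorem HasForm.apply_zero {η : ℂ} {T : U3} (h : HasForm η T) : T.1 0 0 = η := by
  rcases h with h | h <;> simp [h]

/-- This identifies the cyclic factor of `Ḡ` as the group generated by `z`, so that `q` is the order
of `z`. -/
theorem range_entryHom_zpowers {z : unitary ℂ} {T : U3} (h : HasForm z T)
    (hd : ∀ R ∈ Subgroup.zpowers T, IsDiagonal R) :
    (entryHom (Subgroup.zpowers T) hd).range = Subgroup.zpowers z := by
  have hT : entryHom _ hd ⟨T, Subgroup.mem_zpowers T⟩ = z := Subtype.ext h.apply_zero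
  have htop : (⊤ : Subgroup (Subgroup.zpowers T)) =
      Subgroup.zpowers ⟨T, Subgroup.mem_zpowers T⟩ := by
    rw [eq_comm, eq_top_iff]
    rintro ⟨_, n, rfl⟩ -
    exact ⟨n, rfl⟩
  rw [MonoidHom.range_eq_map, htop, MonoidHom.map_zpowers, hT]

theorem isCyclicTimesS4_zpowers {z : unitary ℂ} (hz : IsOfFinOrder z) {T : U3}
    (h : HasForm z T) : IsCyclicTimesS4 (orderOf z) (Gbar (Subgroup.zpowers T)) := by
  have := (isChargedLeptonGroup_zpowers hz h).isCyclicTimesS4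
  rwa [range_entryHom_zpowers h, Nat.card_zpowers] at this

/-! ### The mixing matrix -/

/-- Serves twice: with the entries of a residual symmetry for `M_ℓ M_ℓ†`, and with the squared
masses for `U_ℓ`. -/
theorem isDiag_of_commute_diagonal {n : Type*} [Fintype n] [DecidableEq n] {A : Matrix n n ℂ}
    {d : n → ℂ} (hd : Function.Injective d) (h : Matrix.diagonal d * A = A * Matrix.diagonal d) :
    A.IsDiag := by
  intro i j hij
  have := congrFun₂ h i j
  rw [Matrix.diagonal_mul, Matrix.mul_diagonal, mul_comm] at this
  by_contra hA
  exact hij (hd (mul_left_cancel₀ hA this))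

theorem coe_mul_conjTranspose (U : U3) :
    (U : Matrix (Fin 3) (Fin 3) ℂ) * (U : Matrix (Fin 3) (Fin 3) ℂ)ᴴ = 1 :=
  Matrix.mem_unitaryGroup_iff.1 U.2

theorem IsChargedLeptonGroup.isDiag_of_chargedInvariant {Gl : Subgroup U3}
    (h : IsChargedLeptonGroup Gl) {Ml : Matrix (Fin 3) (Fin 3) ℂ} (hM : ChargedInvariant Gl Ml) :
    (Ml * Mlᴴ).IsDiag := by
  obtain ⟨T, hT, z, hz⟩ := h.exists_hasForm
  refine isDiag_of_commute_diagonal (hz.injective_entry Unitary.isUnit_coe.ne_zero) ?_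
  rw [← (h.diagonal T hT).eq_diagonal]
  nth_rw 1 [← hM T hT]
  rw [← Matrix.mul_assoc, ← Matrix.mul_assoc, coe_mul_conjTranspose, Matrix.one_mul]

theorem star_u₁ : star u₁ = u₁ := by
  ext i
  fin_cases i <;> simp [u₁]

theorem dotProduct_u₁ : u₁ ⬝ᵥ u₁ = 1 := by
  have h6 : ((Real.sqrt 6 : ℝ) : ℂ) * ((Real.sqrt 6 : ℝ) : ℂ) = 6 := by
    rw [← Complex.ofReal_mul, Real.mul_self_sqrt (by norm_num)]
    norm_num
  simp [u₁, dotProduct, Fin.sum_univ_three, div_mul_div_comm, h6]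
  norm_num

theorem sTildeMatrix_mulVec (v : Fin 3 → ℂ) :
    STildeMatrix *ᵥ v = (2 * (u₁ ⬝ᵥ v)) • u₁ - v := by
  rw [STildeMatrix, Matrix.sub_mulVec, Matrix.smul_mulVec, Matrix.vecMulVec_mulVec, star_u₁,
    Matrix.one_mulVec, mul_smul, op_smul_eq_smul]

theorem sTildeMatrix_mulVec_u₁ : STildeMatrix *ᵥ u₁ = u₁ := by
  rw [sTildeMatrix_mulVec, dotProduct_u₁, mul_one, two_smul, add_sub_cancel_right]

theorem transpose_sTildeMatrix : STildeMatrixᵀ = STildeMatrix := by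
  rw [STildeMatrix, star_u₁, Matrix.transpose_sub, Matrix.transpose_smul,
    Matrix.transpose_vecMulVec, Matrix.transpose_one]

/-- An invariant neutrino mass matrix has `u₁` as an eigenvector. -/
theorem NeutrinoInvariant.exists_mulVec_u₁ {Mn : Matrix (Fin 3) (Fin 3) ℂ}
    (h : NeutrinoInvariant Gν Mn) : ∃ μ : ℂ, Mn *ᵥ u₁ = μ • u₁ := by
  have h1 : STildeMatrixᵀ * Mn * STildeMatrix = Mn := h STilde (Subgroup.mem_zpowers STilde)
  -- `S̃` is symmetric and fixes `u₁`, so it also fixes `M_ν u₁`; its fixed space is the line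
  -- through `u₁`.
  have h2 : STildeMatrix *ᵥ (Mn *ᵥ u₁) = Mn *ᵥ u₁ := by
    conv_rhs => rw [← h1]
    rw [← Matrix.mulVec_mulVec, ← Matrix.mulVec_mulVec, sTildeMatrix_mulVec_u₁,
      transpose_sTildeMatrix]
  rw [sTildeMatrix_mulVec] at h2
  refine ⟨u₁ ⬝ᵥ Mn *ᵥ u₁, ?_⟩
  ext i
  have := congrFun h2 i
  simp only [Pi.sub_apply, Pi.smul_apply, smul_eq_mul] at this ⊢
  linear_combination (-1 / 2) * this

/-- Takagi vectors for distinct singular values `m`: if `diag(m) w = μ w*`, then `w` has a single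
nonzero entry. -/
theorem eq_single_of_diagonal_mulVec {n : Type*} [DecidableEq n] {m : n → ℝ} (h0 : ∀ i, 0 ≤ m i)
    (hm : Function.Injective m) {w : n → ℂ} (hw : w ≠ 0) {μ : ℂ}
    (h : ∀ i, (m i : ℂ) * w i = μ * star (w i)) : ∃ j, w j ≠ 0 ∧ w = Pi.single j (w j) := by
  -- Norms remove the phases, so all masses on the support of `w` coincide.
  have key (i : n) (hi : w i ≠ 0) : m i = ‖μ‖ := by
    have := congrArg norm (h i)
    rw [norm_mul, norm_mul, norm_star, Complex.norm_of_nonneg (h0 i)] at this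
    exact mul_right_cancel₀ (norm_ne_zero_iff.2 hi) this
  obtain ⟨j, hj⟩ := Function.ne_iff.1 hw
  refine ⟨j, hj, ?_⟩
  ext i
  by_cases hij : i = j
  · rw [hij, Pi.single_eq_same]
  · rw [Pi.single_eq_of_ne hij]
    by_contra hi
    exact hij (hm ((key i hi).trans (key j hj).symm))

/-- Put `w = U_ν† u₁`. As `u₁` is real, `diag(m) w = U_νᵀ M_ν u₁ = μ w*`, so `w` is supported at one
index `j`, and `u₁` is `w j` times column `j` of `U_ν`. -/
theorem exists_column_of_takagi {Mn : Matrix (Fin 3) (Fin 3) ℂ} {mn : Fin 3 → ℝ}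
    (h0 : ∀ i, 0 ≤ mn i) (hmn : Function.Injective mn) {Un : U3}
    (hUn : (Un : Matrix (Fin 3) (Fin 3) ℂ)ᵀ * Mn * (Un : Matrix (Fin 3) (Fin 3) ℂ)
      = Matrix.diagonal (fun i => ((mn i : ℝ) : ℂ)))
    {μ : ℂ} (hμ : Mn *ᵥ u₁ = μ • u₁) :
    ∃ (j : Fin 3) (c : ℂ), ‖c‖ = 1 ∧ ∀ i, Un.1 i j = c * u₁ i := by
  set w : Fin 3 → ℂ := Un.1ᴴ *ᵥ u₁ with hw
  have hUw : Un.1 *ᵥ w = u₁ := by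
    rw [hw, Matrix.mulVec_mulVec, coe_mul_conjTranspose, Matrix.one_mulVec]
  have hw0 : w ≠ 0 := by
    intro h
    have := dotProduct_u₁
    rw [← hUw, h, Matrix.mulVec_zero, zero_dotProduct] at this
    exact zero_ne_one this
  have hws : star w = Un.1ᵀ *ᵥ u₁ := by
    rw [hw, Matrix.star_mulVec, star_u₁, Matrix.conjTranspose_conjTranspose,
      Matrix.mulVec_transpose]
  have hd : Matrix.diagonal (fun i => ((mn i : ℝ) : ℂ)) *ᵥ w = μ • star w := by
    rw [← hUn, ← Matrix.mulVec_mulVec, hUw, ← Matrix.mulVec_mulVec, hμ, Matrix.mulVec_smul, hws]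
  obtain ⟨j, hj, hwj⟩ := eq_single_of_diagonal_mulVec h0 hmn hw0 (μ := μ) fun i => by
    have := congrFun hd i
    rwa [Matrix.mulVec_diagonal] at this
  have hnorm : w j * star (w j) = 1 := by
    have h1 : w ⬝ᵥ star w = 1 := by
      rw [hws, Matrix.dotProduct_mulVec, Matrix.vecMul_transpose, hUw, dotProduct_u₁]
    have h2 : w ⬝ᵥ star w = w j * star (w j) := by
      rw [hwj]
      simp
    rw [← h2, h1]
  have hmem : w j ∈ unitary ℂ := Unitary.mem_iff.2 ⟨by rwa [mul_comm], hnorm⟩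
  refine ⟨j, star (w j), by rw [norm_star, CStarRing.norm_of_mem_unitary hmem], fun i => ?_⟩
  have : u₁ i = Un.1 i j * w j := by
    rw [← hUw, hwj, Matrix.mulVec_single]
    simp
  rw [this]
  linear_combination (-Un.1 i j) * hnorm

theorem IsChargedLeptonGroup.enforcesTM1 {Gl : Subgroup U3} (h : IsChargedLeptonGroup Gl) :
    EnforcesTM1 Gl Gν := by
  intro Ml Mn _ hl hn
  refine ⟨h.isDiag_of_chargedInvariant hl, ?_⟩
  rintro ml mn _ hl0 hn0 hli hni hM ⟨Ul, Un, hUl, hUn, rfl⟩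
  obtain ⟨μ, hμ⟩ := hn.exists_mulVec_u₁
  obtain ⟨j, c, hc, hj⟩ := exists_column_of_takagi hn0 hni hUn hμ
  -- Nonnegativity keeps the squared masses distinct.
  have hinj : Function.Injective fun i => ((ml i : ℝ) : ℂ) ^ 2 := by
    intro a b hab
    have : ml a ^ 2 = ml b ^ 2 := by
      beta_reduce at hab
      exact_mod_cast hab
    exact hli ((pow_left_inj₀ (hl0 a) (hl0 b) two_ne_zero).1 this)
  -- `U_ℓ` commutes with the non-degenerate diagonal mass matrix, so it is a diagonal matrix of
  -- phases and only rephases the column.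
  have hUd : IsDiagonal Ul := by
    refine isDiag_of_commute_diagonal hinj ?_
    rw [hM] at hUl
    nth_rw 2 [← hUl]
    rw [← Matrix.mul_assoc, ← Matrix.mul_assoc, coe_mul_conjTranspose, Matrix.one_mul]
  refine ⟨j, fun i => star (Ul.1 i i) * c, fun i => ?_, fun i => ?_⟩
  · rw [norm_mul, norm_star, CStarRing.norm_of_mem_unitary (hUd.entry_mem i), hc, one_mul]
  · have hUl' : Ul.1ᴴ = Matrix.diagonal (star fun i => Ul.1 i i) := by
      rw [← Matrix.diagonal_conjTranspose, ← hUd.eq_diagonal]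
    rw [hUl', Matrix.diagonal_mul, hj, mul_assoc]
    rfl

end TM1

theorem theorem2 :
    (∀ T : TM1.U3, TM1.IsDiagonal T →
      ((¬ TM1.IsScalar T ∧ IsOfFinOrder T ∧ IsOfFinOrder (TM1.STilde * T)) ↔
        ∃ (q : ℕ) (η : ℂ), 0 < q ∧ IsPrimitiveRoot η q ∧ TM1.HasForm η T)) ∧
    (∀ (q : ℕ) (η : ℂ) (T : TM1.U3), 0 < q → IsPrimitiveRoot η q → TM1.HasForm η T →
      TM1.IsCyclicTimesS4 q (TM1.Gbar (Subgroup.zpowers T))) ∧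
    (∀ Gl : Subgroup TM1.U3, TM1.IsChargedLeptonGroup Gl →
      TM1.EnforcesTM1 Gl TM1.Gν ∧
        ∃ q : ℕ, 0 < q ∧ TM1.IsCyclicTimesS4 q (TM1.Gbar Gl)) ∧
    (∀ q : ℕ, 0 < q →
      ∃ Gl : Subgroup TM1.U3, TM1.IsChargedLeptonGroup Gl ∧
        TM1.EnforcesTM1 Gl TM1.Gν ∧ TM1.IsCyclicTimesS4 q (TM1.Gbar Gl)) := by
  have lift (q : ℕ) (η : ℂ) (hq : 0 < q) (hη : IsPrimitiveRoot η q) :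
      ∃ z : unitary ℂ, (z : ℂ) = η ∧ IsOfFinOrder z ∧ orderOf z = q := by
    have hz : IsPrimitiveRoot (⟨η, TM1.mem_unitary_of_isPrimitiveRoot hq hη⟩ : unitary ℂ) q :=
      IsPrimitiveRoot.of_map_of_injective (f := (unitary ℂ).subtype) hη Subtype.coe_injective
    exact ⟨_, rfl, hz.isOfFinOrder hq.ne', hz.eq_orderOf.symm⟩
  have cyclic (q : ℕ) (η : ℂ) (T : TM1.U3) (hq : 0 < q) (hη : IsPrimitiveRoot η q)
      (hT : TM1.HasForm η T) : TM1.IsChargedLeptonGroup (Subgroup.zpowers T) ∧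
        TM1.IsCyclicTimesS4 q (TM1.Gbar (Subgroup.zpowers T)) := by
    obtain ⟨z, rfl, hz, rfl⟩ := lift q η hq hη
    exact ⟨TM1.isChargedLeptonGroup_zpowers hz hT, TM1.isCyclicTimesS4_zpowers hz hT⟩
  refine ⟨fun T hT => ⟨?_, ?_⟩, fun q η T hq hη hT => (cyclic q η T hq hη hT).2,
    fun Gl h => ⟨h.enforcesTM1, _, ?_, h.isCyclicTimesS4⟩, fun q hq => ?_⟩
  · rintro ⟨hs, h, hS⟩
    -- Here `η` is the first diagonal entry and `q` its order.
    exact ⟨_, _, (hT.isOfFinOrder_entry h 0).orderOf_pos, IsPrimitiveRoot.orderOf _,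
      TM1.hasForm_of_isOfFinOrder hT hs h hS⟩
  · rintro ⟨q, η, hq, hη, h⟩
    have hG := (cyclic q η T hq hη h).1
    have hmem := Subgroup.mem_zpowers T
    exact ⟨h.not_isScalar (hη.ne_zero hq.ne'), hG.isOfFinOrder hmem, hG.finOrder T hmem⟩
  · have := h.finite_range
    exact Nat.card_pos
  · have hη := Complex.isPrimitiveRoot_exp q hq.ne'
    obtain ⟨z, hz, -⟩ := lift q _ hq hη
    -- The witness is generated by `z ρ(threeCycle)` with `z = exp(2πi/q)`.
    have h := cyclic q _ _ hq hη (hz ▸ TM1.hasForm_iff.2 (Or.inl rfl))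
    exact ⟨_, h.1, h.1.enforcesTM1, h.2⟩
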